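/- Let $\mathbb{D}$ be the open unit disk and $\mathbb{T}$ the unit circle. For $1<q<\infty$ let $H^q$ be the space of holomorphic functions $g$ on $\mathbb{D}$ with $$\|g\|_q^q:=\sup_{0<r<1}\frac1{2\pi}\int_0^{2\pi}|g(re^{i\theta})|^q\,d\theta<\infty .$$ An inner function is a bounded holomorphic function on $\mathbb{D}$ whose non-tangential boundary values have modulus one almost everywhere on $\mathbb{T}$. On $\mathbb{T}$, functions in $H^q$ and inner functions are identified with their non-tangential boundary values, which exist almost everywhere. Let $J_1$ and $J_2$ be non-constant inner functions with $J_1(0)\neq0$ and $J_2(0)\neq0$. Then, for every $1<q<\infty$, both of the following suprema are finite and $$\sup_{g\in H^q,\ \|g\|_q\le1}\left|\frac1{2\pi i}\int_{\mathbb{T}} g\,\overline{J_1}\,d\zeta\right|<\sup_{g\in H^q,\ \|g\|_q\le1}\left|\frac1{2\pi i}\int_{\mathbb{T}} g\,\overline{J_1J_2}\,d\zeta\right| .$$ -/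

import Mathlib

open Set Filter Topology MeasureTheory

noncomputable section

namespace HardyDual

/-- The Stolz (non-tangential approach) region in the open unit disk with vertex `ζ` on the unit
circle and aperture `M > 1`. -/
def stolz (ζ : ℂ) (M : ℝ) : Set ℂ :=
  {z | ‖z‖ < 1 ∧ ‖z - ζ‖ < M * (1 - ‖z‖)}

/-- `f` has the non-tangential limit `c` at the point `ζ` of the unit circle. -/
def HasNontangentialLimit (f : ℂ → ℂ) (ζ c : ℂ) : Prop :=
  ∀ M : ℝ, 1 < M → Tendsto f (𝓝[stolz ζ M] ζ) (𝓝 c)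

/-- `F` is the boundary function of `f` on the unit circle: at almost every point of the circle,
`F` is the non-tangential limit of `f`. This determines `F` on the circle up to a null set. -/
def IsBoundaryFunction (f F : ℂ → ℂ) : Prop :=
  ∀ᵐ θ : ℝ, HasNontangentialLimit f (circleMap 0 1 θ) (F (circleMap 0 1 θ))

/-- The set of the integral means `(1/2π) ∫₀^{2π} |f(r e^{iθ})|^q dθ`, `0 < r < 1`. -/
def integralMeans (q : ℝ) (f : ℂ → ℂ) : Set ℝ :=
  (fun r : ℝ => Real.circleAverage (fun z => ‖f z‖ ^ q) 0 r) '' Ioo 0 1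

/-- `f` belongs to the Hardy space `H^q` of the unit disk (`0 < q < ∞`). Only the values of `f`
in the open unit disk matter. -/
def MemHardy (q : ℝ) (f : ℂ → ℂ) : Prop :=
  DifferentiableOn ℂ f (Metric.ball 0 1) ∧ BddAbove (integralMeans q f)

/-- The norm of `H^q`. -/
def hardyNorm (q : ℝ) (f : ℂ → ℂ) : ℝ :=
  sSup (integralMeans q f) ^ (1 / q)

/-- `J` is an inner function: a bounded holomorphic function on the unit disk whose boundary
values have modulus one almost everywhere. -/
def IsInner (J : ℂ → ℂ) : Prop :=
  DifferentiableOn ℂ J (Metric.ball 0 1) ∧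
    (∃ C : ℝ, ∀ z ∈ Metric.ball (0 : ℂ) 1, ‖J z‖ ≤ C) ∧
    ∃ F : ℂ → ℂ, IsBoundaryFunction J F ∧ ∀ᵐ θ : ℝ, ‖F (circleMap 0 1 θ)‖ = 1

/-- `J` is constant on the open unit disk. -/
def IsConstantOnDisk (J : ℂ → ℂ) : Prop :=
  ∃ c : ℂ, ∀ z ∈ Metric.ball (0 : ℂ) 1, J z = c

/-- The set of all `|(1/2πi) ∫_𝕋 g conj(J) dζ|` where `g` runs over the closed unit ball of `H^q`;
on the circle, `g` and `J` stand for their boundary functions `G` and `F`. -/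
def dualValues (q : ℝ) (J : ℂ → ℂ) : Set ℝ :=
  {x | ∃ g G F : ℂ → ℂ, MemHardy q g ∧ hardyNorm q g ≤ 1 ∧
    IsBoundaryFunction g G ∧ IsBoundaryFunction J F ∧
    x = ‖(2 * (Real.pi : ℂ) * Complex.I)⁻¹ *
      ∮ ζ in C(0, 1), G ζ * (starRingEnd ℂ) (F ζ)‖}

end HardyDual

end

/-! Write `a = J 0` with `|a| < 1`. The supremum is a maximum, equal to `(1 - |a|²)^(1 - 1/q)`.
Passing from `J₁` to `J₁ J₂` strictly decreases `|a|`: `|J₂ 0| < 1` by the maximum principle, and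
`J₁ 0 ≠ 0`. Hence the value strictly increases.

Upper bound: since `dζ = iζ dθ`, the pairing is the mean of `ζ g conj J`. With `p` conjugate to `q`,
write `(1 - conj a w)^(2/p) = 1 + w X(w)`. The mean of `ζ g X(J)` is zero, so `conj J` may be
replaced by `conj J + X(J)`, which has modulus `|1 - conj a J|^(2/p)` on the circle. Hölder and `∫
|1 - conj a J|² = 1 - |a|²` finish.

Attainment: a suitably normalized `(J - a)/z · (1 - conj a J)^(2/q - 1)` is in the unit ball by
Schwarz–Pick, and its pairing is computed by the mean value property (`MemHardy.integral_boundary`).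
-/

noncomputable section

namespace HardyDual

open scoped ComplexConjugate

/-! ### Normalized arc length and radial approach -/

/-- The normalized arc length measure of the unit circle, in the angular coordinate. -/
def circleMeasure : Measure ℝ :=
  ENNReal.ofReal (2 * Real.pi)⁻¹ • volume.restrict (Ioc 0 (2 * Real.pi))

instance : IsProbabilityMeasure circleMeasure := by
  constructor
  simp only [circleMeasure, Measure.smul_apply, Measure.restrict_apply_univ, Real.volume_Ioc,
    sub_zero, smul_eq_mul]
  rw [← ENNReal.ofReal_mul (by positivity), inv_mul_cancel₀ (by positivity), ENNReal.ofReal_one]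

theorem circleAverage_eq_integral {E : Type*} [NormedAddCommGroup E] [NormedSpace ℝ E]
    (f : ℂ → E) (r : ℝ) :
    Real.circleAverage f 0 r = ∫ θ, f (circleMap 0 r θ) ∂circleMeasure := by
  rw [Real.circleAverage_def, circleMeasure, integral_smul_measure,
    ENNReal.toReal_ofReal (by positivity), intervalIntegral.integral_of_le (by positivity)]

theorem ae_circleMeasure {P : ℝ → Prop} (h : ∀ᵐ θ : ℝ, P θ) : ∀ᵐ θ ∂circleMeasure, P θ :=
  Measure.ae_smul_measure (ae_restrict_of_ae h) _

theorem integral_eq_circleIntegral (f : ℂ → ℂ) :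
    (2 * (Real.pi : ℂ) * Complex.I)⁻¹ * (∮ ζ in C(0, 1), f ζ) =
      ∫ θ, circleMap 0 1 θ * f (circleMap 0 1 θ) ∂circleMeasure := by
  rw [← circleAverage_eq_integral (fun z => z * f z),
    Real.circleAverage_eq_circleIntegral one_ne_zero, smul_eq_mul]
  congr 1
  refine circleIntegral.integral_congr zero_le_one fun z hz => ?_
  have hz0 : z ≠ 0 := by
    rintro rfl
    simp at hz
  simp [hz0]

/-- A sequence of radii in `(0, 1)` that increases to `1`. -/
def radius (n : ℕ) : ℝ := 1 - 1 / ((n : ℝ) + 2)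

theorem radius_mem (n : ℕ) : radius n ∈ Ioo (0 : ℝ) 1 := by
  have h : (0 : ℝ) < (n : ℝ) + 2 := by positivity
  have h1 : 1 / ((n : ℝ) + 2) < 1 := by
    rw [div_lt_one h]
    linarith [(Nat.cast_nonneg n : (0 : ℝ) ≤ n)]
  have h2 : 0 < 1 / ((n : ℝ) + 2) := by positivity
  constructor <;> simp only [radius] <;> linarith

theorem tendsto_radius : Tendsto radius atTop (𝓝 1) := by
  have h : Tendsto (fun n : ℕ => 1 / ((n : ℝ) + 2)) atTop (𝓝 0) :=
    tendsto_const_nhds.div_atTop (tendsto_natCast_atTop_atTop.atTop_add tendsto_const_nhds)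
  have h1 := (tendsto_const_nhds (x := (1 : ℝ))).sub h
  rw [sub_zero] at h1
  exact h1

theorem norm_circleMap_of_pos {r : ℝ} (hr : 0 < r) (θ : ℝ) : ‖circleMap 0 r θ‖ = r := by
  simp [abs_of_pos hr]

theorem circleMap_mem_unitBall {r : ℝ} (hr : r ∈ Ioo (0 : ℝ) 1) (θ : ℝ) :
    circleMap 0 r θ ∈ Metric.ball (0 : ℂ) 1 := by
  rw [mem_ball_zero_iff, norm_circleMap_of_pos hr.1]
  exact hr.2

theorem circleMap_one_ne_zero (θ : ℝ) : circleMap 0 1 θ ≠ 0 :=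
  circleMap_ne_center one_ne_zero

/-! ### Boundary functions -/

theorem HasNontangentialLimit.tendsto_radius {f : ℂ → ℂ} {θ : ℝ} {c : ℂ}
    (h : HasNontangentialLimit f (circleMap 0 1 θ) c) :
    Tendsto (fun n => f (circleMap 0 (radius n) θ)) atTop (𝓝 c) := by
  -- On a radius `‖z - ζ‖ = 1 - ‖z‖`, so any aperture above `1` would do.
  refine (h 2 one_lt_two).comp (tendsto_nhdsWithin_iff.2 ⟨?_, Eventually.of_forall fun n => ?_⟩)
  · have hc : Continuous fun r : ℝ => circleMap 0 r θ := by
      unfold circleMap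
      fun_prop
    exact (hc.tendsto 1).comp HardyDual.tendsto_radius
  · have hn := radius_mem n
    have h1 : circleMap 0 (radius n) θ - circleMap 0 1 θ =
        ((radius n - 1 : ℝ) : ℂ) * circleMap 0 1 θ := by
      simp only [circleMap, Complex.ofReal_sub, Complex.ofReal_one]
      ring
    refine ⟨?_, ?_⟩
    · rw [norm_circleMap_of_pos hn.1]
      exact hn.2
    · rw [h1, norm_mul, norm_circleMap_of_pos one_pos, norm_circleMap_of_pos hn.1,
        Complex.norm_real, Real.norm_eq_abs, abs_of_neg (by linarith [hn.2])]
      linarith [hn.2]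

theorem IsBoundaryFunction.ae_tendsto {f F : ℂ → ℂ} (h : IsBoundaryFunction f F) :
    ∀ᵐ θ ∂circleMeasure, Tendsto (fun n => f (circleMap 0 (radius n) θ)) atTop
      (𝓝 (F (circleMap 0 1 θ))) :=
  (ae_circleMeasure h).mono fun _ hθ => hθ.tendsto_radius

theorem IsBoundaryFunction.ae_eq {f F F' : ℂ → ℂ} (h : IsBoundaryFunction f F)
    (h' : IsBoundaryFunction f F') :
    ∀ᵐ θ : ℝ, F (circleMap 0 1 θ) = F' (circleMap 0 1 θ) := by
  filter_upwards [h, h'] with θ h1 h2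
  exact tendsto_nhds_unique h1.tendsto_radius h2.tendsto_radius

theorem IsBoundaryFunction.mul {f F g G : ℂ → ℂ} (hf : IsBoundaryFunction f F)
    (hg : IsBoundaryFunction g G) :
    IsBoundaryFunction (fun z => f z * g z) (fun z => F z * G z) := by
  filter_upwards [hf, hg] with θ h1 h2 M hM
  exact (h1 M hM).mul (h2 M hM)

theorem isBoundaryFunction_of_continuousAt {φ : ℂ → ℂ}
    (hφ : ∀ w : ℂ, ‖w‖ = 1 → ContinuousAt φ w) : IsBoundaryFunction φ φ := by
  refine Eventually.of_forall fun θ M _ => ?_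
  exact (hφ _ (norm_circleMap_of_pos one_pos θ)).tendsto.mono_left nhdsWithin_le_nhds

theorem IsBoundaryFunction.comp_continuousAt {f F φ : ℂ → ℂ} (hf : IsBoundaryFunction f F)
    (hF : ∀ᵐ θ : ℝ, ContinuousAt φ (F (circleMap 0 1 θ))) :
    IsBoundaryFunction (fun z => φ (f z)) (fun z => φ (F z)) := by
  filter_upwards [hf, hF] with θ h1 h2 M hM
  exact h2.tendsto.comp (h1 M hM)

theorem continuous_comp_circleMap {f : ℂ → ℂ} (hf : DifferentiableOn ℂ f (Metric.ball 0 1)) {r : ℝ}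
    (hr : r ∈ Ioo (0 : ℝ) 1) : Continuous fun θ => f (circleMap 0 r θ) :=
  hf.continuousOn.comp_continuous (continuous_circleMap 0 r) (circleMap_mem_unitBall hr)

theorem memLp_of_continuous_of_periodic {f : ℝ → ℂ} (hf : Continuous f)
    (hp : Function.Periodic f (2 * Real.pi)) (p : ENNReal) : MemLp f p circleMeasure := by
  obtain ⟨C, hC⟩ := (hp.isBounded_of_continuous (by positivity) hf).exists_norm_le
  exact MemLp.of_bound hf.aestronglyMeasurable C
    (Eventually.of_forall fun θ => hC _ (mem_range_self θ))

theorem memLp_comp_circleMap {f : ℂ → ℂ} (hf : DifferentiableOn ℂ f (Metric.ball 0 1)) {r : ℝ}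
    (hr : r ∈ Ioo (0 : ℝ) 1) (p : ENNReal) :
    MemLp (fun θ => f (circleMap 0 r θ)) p circleMeasure :=
  memLp_of_continuous_of_periodic (continuous_comp_circleMap hf hr)
    ((periodic_circleMap 0 r).comp f) p

theorem IsBoundaryFunction.aestronglyMeasurable {f F : ℂ → ℂ}
    (hf : DifferentiableOn ℂ f (Metric.ball 0 1)) (h : IsBoundaryFunction f F) :
    AEStronglyMeasurable (fun θ => F (circleMap 0 1 θ)) circleMeasure :=
  aestronglyMeasurable_of_tendsto_ae atTop
    (fun n => (continuous_comp_circleMap hf (radius_mem n)).aestronglyMeasurable) h.ae_tendsto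

theorem integral_comp_circleMap {f : ℂ → ℂ} (hf : DifferentiableOn ℂ f (Metric.ball 0 1)) {r : ℝ}
    (hr : r ∈ Ioo (0 : ℝ) 1) : ∫ θ, f (circleMap 0 r θ) ∂circleMeasure = f 0 := by
  rw [← circleAverage_eq_integral f r]
  refine DiffContOnCl.circleAverage (hf.diffContOnCl_ball ?_)
  rw [abs_of_pos hr.1]
  exact Metric.closedBall_subset_ball hr.2

/-! ### Boundary values of Hardy functions -/

theorem sSup_integralMeans_nonneg (q : ℝ) (f : ℂ → ℂ) : 0 ≤ sSup (integralMeans q f) := by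
  refine Real.sSup_nonneg ?_
  rintro _ ⟨r, -, rfl⟩
  simp only [circleAverage_eq_integral]
  exact integral_nonneg fun θ => by positivity

theorem MemHardy.eLpNorm_le {q : ℝ} (hq : 1 < q) {f : ℂ → ℂ} (hf : MemHardy q f) {r : ℝ}
    (hr : r ∈ Ioo (0 : ℝ) 1) :
    eLpNorm (fun θ => f (circleMap 0 r θ)) (ENNReal.ofReal q) circleMeasure ≤
      ENNReal.ofReal (hardyNorm q f) := by
  have hq0 : 0 < q := by linarith
  rw [(memLp_comp_circleMap hf.1 hr _).eLpNorm_eq_integral_rpow_norm (by simpa using hq0)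
    ENNReal.ofReal_ne_top, ENNReal.toReal_ofReal hq0.le, hardyNorm, one_div]
  refine ENNReal.ofReal_le_ofReal (Real.rpow_le_rpow (integral_nonneg fun θ => by positivity) ?_
    (by positivity))
  refine le_csSup hf.2 ⟨r, hr, ?_⟩
  simp only [circleAverage_eq_integral]

/-- Fatou's lemma along the radii `radius n`. -/
theorem MemHardy.eLpNorm_boundary_le {q : ℝ} (hq : 1 < q) {f F : ℂ → ℂ} (hf : MemHardy q f)
    (h : IsBoundaryFunction f F) :
    eLpNorm (fun θ => F (circleMap 0 1 θ)) (ENNReal.ofReal q) circleMeasure ≤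
      ENNReal.ofReal (hardyNorm q f) :=
  Lp.eLpNorm_le_of_ae_tendsto
    (Eventually.of_forall fun n => hf.eLpNorm_le hq (radius_mem n))
    (fun n => (continuous_comp_circleMap hf.1 (radius_mem n)).aestronglyMeasurable) h.ae_tendsto

theorem MemHardy.memLp_boundary {q : ℝ} (hq : 1 < q) {f F : ℂ → ℂ} (hf : MemHardy q f)
    (h : IsBoundaryFunction f F) :
    MemLp (fun θ => F (circleMap 0 1 θ)) (ENNReal.ofReal q) circleMeasure :=
  ⟨h.aestronglyMeasurable hf.1, (hf.eLpNorm_boundary_le hq h).trans_lt ENNReal.ofReal_lt_top⟩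

/-- A sequence that is bounded in `L^q` for some `q > 1` is uniformly integrable. -/
theorem unifIntegrable_one_of_eLpNorm_le {α ι : Type*} [MeasurableSpace α] {μ : Measure α}
    {q : ℝ} (hq : 1 < q) {f : ι → α → ℂ} (hf : ∀ i, AEStronglyMeasurable (f i) μ) {C : ℝ}
    (hC : ∀ i, eLpNorm (f i) (ENNReal.ofReal q) μ ≤ ENNReal.ofReal C) :
    UnifIntegrable f 1 μ := by
  intro ε hε
  have hq0 : 0 < q := by linarith
  have hs : 0 < 1 - 1 / q := by
    rw [sub_pos, div_lt_one hq0]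
    exact hq
  -- Hölder bounds the `L¹` norm over `s` by `C μ(s)^(1 - 1/q)`; this choice makes it at most `ε`.
  -- Using `|C| + 1` keeps the denominator positive.
  refine ⟨(ε / (|C| + 1)) ^ (1 - 1 / q)⁻¹, by positivity, fun i s hs' hμ => ?_⟩
  rw [eLpNorm_indicator_eq_eLpNorm_restrict hs']
  have h1 : (1 : ENNReal) ≤ ENNReal.ofReal q := by
    rw [← ENNReal.ofReal_one]
    exact ENNReal.ofReal_le_ofReal hq.le
  calc eLpNorm (f i) 1 (μ.restrict s)
      ≤ eLpNorm (f i) (ENNReal.ofReal q) (μ.restrict s) *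
        (μ.restrict s) univ ^ (1 / (1 : ENNReal).toReal - 1 / (ENNReal.ofReal q).toReal) :=
        eLpNorm_le_eLpNorm_mul_rpow_measure_univ h1 (hf i).restrict
    _ ≤ ENNReal.ofReal (|C| + 1) *
        ENNReal.ofReal ((ε / (|C| + 1)) ^ (1 - 1 / q)⁻¹) ^ (1 - 1 / q) := by
        rw [ENNReal.toReal_ofReal hq0.le, ENNReal.toReal_one, Measure.restrict_apply_univ, div_one]
        gcongr
        refine (eLpNorm_mono_measure _ Measure.restrict_le_self).trans ((hC i).trans ?_)
        exact ENNReal.ofReal_le_ofReal (by linarith [le_abs_self C])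
    _ = ENNReal.ofReal ε := by
        rw [ENNReal.ofReal_rpow_of_nonneg (by positivity) hs.le,
          ← ENNReal.ofReal_mul (by positivity), ← Real.rpow_mul (by positivity),
          inv_mul_cancel₀ hs.ne', Real.rpow_one]
        congr 1
        field_simp

/-- The mean value property of `H^q` functions, in terms of their boundary values. -/
theorem MemHardy.integral_boundary {q : ℝ} (hq : 1 < q) {f F : ℂ → ℂ} (hf : MemHardy q f)
    (h : IsBoundaryFunction f F) : ∫ θ, F (circleMap 0 1 θ) ∂circleMeasure = f 0 := by
  have h1 : (1 : ENNReal) ≤ ENNReal.ofReal q := by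
    rw [← ENNReal.ofReal_one]
    exact ENNReal.ofReal_le_ofReal hq.le
  have hm n := (continuous_comp_circleMap hf.1 (radius_mem n)).aestronglyMeasurable
    (μ := circleMeasure)
  have hF : MemLp (fun θ => F (circleMap 0 1 θ)) 1 circleMeasure :=
    (hf.memLp_boundary hq h).mono_exponent h1
  -- Vitali's theorem: uniform integrability upgrades a.e. convergence to `L¹` convergence.
  have hlim := tendsto_Lp_finite_of_tendsto_ae le_rfl ENNReal.one_ne_top hm hF
    (unifIntegrable_one_of_eLpNorm_le hq hm fun n => hf.eLpNorm_le hq (radius_mem n)) h.ae_tendsto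
  have h2 := tendsto_integral_of_L1' _ hF.1
    (Eventually.of_forall fun n =>
      memLp_one_iff_integrable.1 (memLp_comp_circleMap hf.1 (radius_mem n) 1)) hlim
  refine tendsto_nhds_unique h2 ?_
  simp only [fun n => integral_comp_circleMap hf.1 (radius_mem n)]
  exact tendsto_const_nhds

theorem memHardy_of_integral_le {q C : ℝ} {f : ℂ → ℂ}
    (hf : DifferentiableOn ℂ f (Metric.ball 0 1))
    (h : ∀ r ∈ Ioo (0 : ℝ) 1, ∫ θ, ‖f (circleMap 0 r θ)‖ ^ q ∂circleMeasure ≤ C) :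
    MemHardy q f ∧ sSup (integralMeans q f) ≤ C := by
  have hle : ∀ x ∈ integralMeans q f, x ≤ C := by
    rintro _ ⟨r, hr, rfl⟩
    simpa only [circleAverage_eq_integral] using h r hr
  refine ⟨⟨hf, C, hle⟩, csSup_le ?_ hle⟩
  exact (nonempty_Ioo.2 zero_lt_one).image _

theorem MemHardy.mul_bounded {q : ℝ} (hq : 1 < q) {f g : ℂ → ℂ} (hf : MemHardy q f)
    (hg : DifferentiableOn ℂ g (Metric.ball 0 1)) {C : ℝ}
    (hC : ∀ z ∈ Metric.ball (0 : ℂ) 1, ‖g z‖ ≤ C) : MemHardy q (fun z => f z * g z) := by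
  have hq0 : 0 < q := by linarith
  obtain ⟨B, hB⟩ := hf.2
  have hC0 : 0 ≤ C := (norm_nonneg _).trans (hC 0 (by simp))
  refine (memHardy_of_integral_le (C := C ^ q * B) (hf.1.mul hg) fun r hr => ?_).1
  have hi : Integrable (fun θ => ‖f (circleMap 0 r θ)‖ ^ q) circleMeasure := by
    have := (memLp_comp_circleMap hf.1 hr (ENNReal.ofReal q)).integrable_norm_rpow'
    rwa [ENNReal.toReal_ofReal hq0.le] at this
  calc ∫ θ, ‖f (circleMap 0 r θ) * g (circleMap 0 r θ)‖ ^ q ∂circleMeasure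
      ≤ ∫ θ, C ^ q * ‖f (circleMap 0 r θ)‖ ^ q ∂circleMeasure := by
        refine integral_mono_of_nonneg (Eventually.of_forall fun θ => by positivity)
          (hi.const_mul _) (Eventually.of_forall fun θ => ?_)
        simp only
        rw [norm_mul, Real.mul_rpow (norm_nonneg _) (norm_nonneg _), mul_comm]
        gcongr
        exact hC _ (circleMap_mem_unitBall hr θ)
    _ ≤ C ^ q * B := by
        rw [integral_const_mul]
        gcongr
        refine hB ⟨r, hr, ?_⟩
        simp only [circleAverage_eq_integral]

theorem memHardy_of_bounded {q : ℝ} (hq : 1 < q) {f : ℂ → ℂ}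
    (hf : DifferentiableOn ℂ f (Metric.ball 0 1)) {C : ℝ}
    (hC : ∀ z ∈ Metric.ball (0 : ℂ) 1, ‖f z‖ ≤ C) : MemHardy q f := by
  have h1 : MemHardy q fun _ => (1 : ℂ) :=
    (memHardy_of_integral_le (C := 1) (differentiableOn_const _) fun r _ => by simp).1
  simpa using h1.mul_bounded hq hf hC

/-! ### Inner functions -/

theorem IsInner.ae_norm_eq_one {J F : ℂ → ℂ} (hJ : IsInner J) (hF : IsBoundaryFunction J F) :
    ∀ᵐ θ : ℝ, ‖F (circleMap 0 1 θ)‖ = 1 := by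
  obtain ⟨F', hF', h1⟩ := hJ.2.2
  filter_upwards [hF.ae_eq hF', h1] with θ h2 h3
  rw [h2, h3]

theorem IsInner.mul {J₁ J₂ : ℂ → ℂ} (h₁ : IsInner J₁) (h₂ : IsInner J₂) :
    IsInner fun z => J₁ z * J₂ z := by
  obtain ⟨d₁, ⟨C₁, hC₁⟩, F₁, hF₁, hn₁⟩ := h₁
  obtain ⟨d₂, ⟨C₂, hC₂⟩, F₂, hF₂, hn₂⟩ := h₂
  refine ⟨d₁.mul d₂, ⟨C₁ * C₂, fun z hz => ?_⟩, _, hF₁.mul hF₂, ?_⟩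
  · rw [norm_mul]
    exact mul_le_mul (hC₁ z hz) (hC₂ z hz) (norm_nonneg _) ((norm_nonneg _).trans (hC₁ z hz))
  · filter_upwards [hn₁, hn₂] with θ h1 h2
    rw [norm_mul, h1, h2, one_mul]

/-- Cauchy's formula on the circle of radius `r`, whose kernel `z / (z - w)` is at most `r / (r -
‖w‖)` in modulus. -/
theorem norm_le_integral_norm {f : ℂ → ℂ} (hf : DifferentiableOn ℂ f (Metric.ball 0 1)) {r : ℝ}
    (hr : r ∈ Ioo (0 : ℝ) 1) {w : ℂ} (hw : ‖w‖ < r) :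
    ‖f w‖ ≤ r / (r - ‖w‖) * ∫ θ, ‖f (circleMap 0 r θ)‖ ∂circleMeasure := by
  have hd : DiffContOnCl ℂ f (Metric.ball 0 |r|) := by
    refine hf.diffContOnCl_ball ?_
    rw [abs_of_pos hr.1]
    exact Metric.closedBall_subset_ball hr.2
  have h1 := hd.circleAverage_smul_div (w := w) (by rw [abs_of_pos hr.1]; simpa using hw)
  rw [← h1, circleAverage_eq_integral, ← integral_const_mul]
  refine norm_integral_le_of_norm_le
    (((memLp_one_iff_integrable.1 (memLp_comp_circleMap hf hr 1)).norm).const_mul _)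
    (Eventually.of_forall fun θ => ?_)
  rw [sub_zero, norm_smul, norm_div, norm_circleMap_of_pos hr.1]
  have h2 : r - ‖w‖ ≤ ‖circleMap 0 r θ - w‖ := by
    have := norm_sub_norm_le (circleMap 0 r θ) w
    rwa [norm_circleMap_of_pos hr.1] at this
  have h3 : 0 < r - ‖w‖ := by linarith
  have h4 := hr.1.le
  gcongr

/-- Cauchy's formula for the powers `J ^ n` gives `‖J w‖ ^ n ≤ (1 - ‖w‖)⁻¹` for all `n`. -/
theorem IsInner.norm_le_one {J : ℂ → ℂ} (hJ : IsInner J) {w : ℂ} (hw : w ∈ Metric.ball (0 : ℂ) 1) :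
    ‖J w‖ ≤ 1 := by
  obtain ⟨hd, ⟨C, hC⟩, F, hF, hn⟩ := hJ
  have hw1 : ‖w‖ < 1 := by simpa using hw
  have hpow : ∀ n : ℕ, ‖J w‖ ^ n ≤ 1 / (1 - ‖w‖) := by
    intro n
    have hlim : Tendsto (fun k => ∫ θ, ‖J (circleMap 0 (radius k) θ) ^ n‖ ∂circleMeasure) atTop
        (𝓝 (∫ _, (1 : ℝ) ∂circleMeasure)) := by
      refine tendsto_integral_of_dominated_convergence (fun _ => C ^ n) (fun k => ?_)
        (integrable_const _) (fun k => Eventually.of_forall fun θ => ?_) ?_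
      · exact ((continuous_comp_circleMap hd (radius_mem k)).pow n).norm.aestronglyMeasurable
      · rw [norm_norm, norm_pow]
        exact pow_le_pow_left₀ (norm_nonneg _) (hC _ (circleMap_mem_unitBall (radius_mem k) θ)) n
      · filter_upwards [hF.ae_tendsto, ae_circleMeasure hn] with θ h1 h2
        have := (h1.pow n).norm
        rwa [norm_pow, h2, one_pow] at this
    have hlim' : Tendsto (fun k => radius k / (radius k - ‖w‖) *
        ∫ θ, ‖J (circleMap 0 (radius k) θ) ^ n‖ ∂circleMeasure) atTop (𝓝 (1 / (1 - ‖w‖) * 1)) := by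
      refine (tendsto_radius.div (tendsto_radius.sub_const _) (by linarith)).mul ?_
      simpa using hlim
    rw [mul_one] at hlim'
    refine ge_of_tendsto hlim' ?_
    filter_upwards [tendsto_radius.eventually (lt_mem_nhds hw1)] with k hk
    rw [← norm_pow]
    exact norm_le_integral_norm (hd.pow n) (radius_mem k) hk
  by_contra! hlt
  obtain ⟨n, hn⟩ := pow_unbounded_of_one_lt (1 / (1 - ‖w‖)) hlt
  exact absurd (hpow n) (not_le.2 hn)

/-- Otherwise `‖J‖` peaks at the origin, and the maximum principle makes `J` constant. -/
theorem IsInner.norm_zero_lt_one {J : ℂ → ℂ} (hJ : IsInner J) (hc : ¬ IsConstantOnDisk J) :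
    ‖J 0‖ < 1 := by
  refine lt_of_le_of_ne (hJ.norm_le_one (by simp)) fun h => hc ⟨J 0, fun z hz => ?_⟩
  refine Complex.eqOn_of_isPreconnected_of_isMaxOn_norm (convex_ball (0 : ℂ) 1).isPreconnected
    Metric.isOpen_ball hJ.1 (by simp) (fun w hw => ?_) hz
  simpa [h] using hJ.norm_le_one hw

/-! ### Powers of `1 - conj a * w` -/

/-- The principal branch of `(1 - conj a * w) ^ s`. -/
def powFactor (a : ℂ) (s : ℝ) (w : ℂ) : ℂ := (1 - conj a * w) ^ (s : ℂ)

/-- The half plane where `1 - conj a * w` has positive real part. -/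
def factorDomain (a : ℂ) : Set ℂ := {w | 0 < (1 - conj a * w).re}

theorem isOpen_factorDomain (a : ℂ) : IsOpen (factorDomain a) :=
  isOpen_lt continuous_const (by fun_prop)

theorem mem_factorDomain {a w : ℂ} (ha : ‖a‖ < 1) (hw : ‖w‖ ≤ 1) : w ∈ factorDomain a := by
  have h1 : (conj a * w).re ≤ ‖a‖ * ‖w‖ := by
    simpa using Complex.re_le_norm (conj a * w)
  have h2 : ‖a‖ * ‖w‖ ≤ ‖a‖ := mul_le_of_le_one_right (norm_nonneg _) hw
  simp only [factorDomain, mem_ofPred_eq, Complex.sub_re, Complex.one_re]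
  linarith

theorem factor_ne_zero {a w : ℂ} (ha : ‖a‖ < 1) (hw : ‖w‖ ≤ 1) : 1 - conj a * w ≠ 0 := by
  intro h
  have h1 : 0 < (1 - conj a * w).re := mem_factorDomain ha hw
  rw [h, Complex.zero_re] at h1
  exact h1.false

theorem differentiableOn_powFactor (a : ℂ) (s : ℝ) :
    DifferentiableOn ℂ (powFactor a s) (factorDomain a) := by
  intro w hw
  have h1 : DifferentiableAt ℂ (fun w => 1 - conj a * w) w := by fun_prop
  exact (h1.cpow_const (Or.inl hw)).differentiableWithinAt

theorem norm_powFactor (a : ℂ) (s : ℝ) (w : ℂ) : ‖powFactor a s w‖ = ‖1 - conj a * w‖ ^ s :=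
  Complex.norm_cpow_real _ _

/-- The difference quotient of `powFactor a s` at the origin. -/
def powQuotient (a : ℂ) (s : ℝ) : ℂ → ℂ := dslope (powFactor a s) 0

/-- For `‖w‖ = 1`, multiplying by `conj w` gives `conj w + powQuotient a s w`: the conjugate appears
up to a holomorphic term. -/
theorem powFactor_eq (a : ℂ) (s : ℝ) (w : ℂ) :
    powFactor a s w = 1 + w * powQuotient a s w := by
  have h := sub_smul_dslope (powFactor a s) 0 w
  have h0 : powFactor a s 0 = 1 := by simp [powFactor]
  rw [h0, sub_zero, smul_eq_mul] at h
  rw [powQuotient, h]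
  ring

theorem differentiableOn_powQuotient (a : ℂ) (s : ℝ) :
    DifferentiableOn ℂ (powQuotient a s) (factorDomain a) := by
  refine (Complex.differentiableOn_dslope ?_).2 (differentiableOn_powFactor a s)
  exact (isOpen_factorDomain a).mem_nhds (by simp [factorDomain])

/-! ### Holomorphic functions of an inner function -/

section Composition

variable {J F φ : ℂ → ℂ} {a : ℂ}

theorem IsInner.differentiableOn_comp (hJ : IsInner J) (ha : ‖a‖ < 1)
    (hφ : DifferentiableOn ℂ φ (factorDomain a)) :
    DifferentiableOn ℂ (fun z => φ (J z)) (Metric.ball 0 1) :=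
  hφ.comp hJ.1 fun _ hz => mem_factorDomain ha (hJ.norm_le_one hz)

theorem IsInner.exists_norm_comp_le (hJ : IsInner J) (ha : ‖a‖ < 1)
    (hφ : DifferentiableOn ℂ φ (factorDomain a)) :
    ∃ C : ℝ, ∀ z ∈ Metric.ball (0 : ℂ) 1, ‖φ (J z)‖ ≤ C := by
  obtain ⟨C, hC⟩ := (isCompact_closedBall (0 : ℂ) 1).exists_bound_of_continuousOn
    (hφ.continuousOn.mono fun w hw => mem_factorDomain ha (mem_closedBall_zero_iff.1 hw))
  exact ⟨C, fun z hz => hC _ (mem_closedBall_zero_iff.2 (hJ.norm_le_one hz))⟩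

theorem IsInner.isBoundaryFunction_comp (hJ : IsInner J) (hF : IsBoundaryFunction J F)
    (ha : ‖a‖ < 1) (hφ : DifferentiableOn ℂ φ (factorDomain a)) :
    IsBoundaryFunction (fun z => φ (J z)) (fun z => φ (F z)) := by
  refine hF.comp_continuousAt ?_
  filter_upwards [hJ.ae_norm_eq_one hF] with θ hθ
  exact hφ.continuousOn.continuousAt
    ((isOpen_factorDomain a).mem_nhds (mem_factorDomain ha hθ.le))

/-- `φ ∘ J` is bounded because `φ` is continuous on the closed unit disk, so the mean value property
applies. -/
theorem IsInner.integral_comp (hJ : IsInner J) (hF : IsBoundaryFunction J F)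
    (ha : ‖a‖ < 1) (hφ : DifferentiableOn ℂ φ (factorDomain a)) :
    Integrable (fun θ => φ (F (circleMap 0 1 θ))) circleMeasure ∧
      ∫ θ, φ (F (circleMap 0 1 θ)) ∂circleMeasure = φ (J 0) := by
  obtain ⟨C, hC⟩ := hJ.exists_norm_comp_le ha hφ
  have hh := memHardy_of_bounded one_lt_two (hJ.differentiableOn_comp ha hφ) hC
  have hb := hJ.isBoundaryFunction_comp hF ha hφ
  refine ⟨(hh.memLp_boundary one_lt_two hb).integrable ?_, hh.integral_boundary one_lt_two hb⟩
  simp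

end Composition

/-! ### Möbius estimates and quadratic means -/

theorem norm_one_sub_conj_mul_sq (a w : ℂ) :
    ‖1 - conj a * w‖ ^ 2 = 1 - 2 * (conj a * w).re + ‖a‖ ^ 2 * ‖w‖ ^ 2 := by
  rw [← Complex.normSq_eq_norm_sq, ← Complex.normSq_eq_norm_sq, ← Complex.normSq_eq_norm_sq]
  simp only [Complex.normSq_apply, Complex.sub_re, Complex.sub_im, Complex.mul_re, Complex.mul_im,
    Complex.conj_re, Complex.conj_im, Complex.one_re, Complex.one_im]
  ring

/-- The difference of the squares is `(1 - ‖a‖²)(1 - ‖w‖²)`. -/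
theorem norm_sub_le_norm_one_sub {a w : ℂ} (ha : ‖a‖ < 1) (hw : ‖w‖ ≤ 1) :
    ‖w - a‖ ≤ ‖1 - conj a * w‖ := by
  refine le_of_pow_le_pow_left₀ two_ne_zero (norm_nonneg _) ?_
  have h1 : ‖w - a‖ ^ 2 = ‖w‖ ^ 2 - 2 * (conj a * w).re + ‖a‖ ^ 2 := by
    rw [← Complex.normSq_eq_norm_sq, ← Complex.normSq_eq_norm_sq, ← Complex.normSq_eq_norm_sq]
    simp only [Complex.normSq_apply, Complex.sub_re, Complex.sub_im, Complex.mul_re,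
      Complex.conj_re, Complex.conj_im]
    ring
  rw [h1, norm_one_sub_conj_mul_sq]
  have h2 : ‖a‖ ^ 2 ≤ 1 := pow_le_one₀ (norm_nonneg _) ha.le
  have h3 : ‖w‖ ^ 2 ≤ 1 := pow_le_one₀ (norm_nonneg _) hw
  nlinarith

/-- The integrand equals `‖1 - conj a * f‖²` where `‖f‖ = 1` and dominates it where `‖f‖ ≤ 1`. -/
theorem integral_one_sub_two_mul_re {f : ℝ → ℂ} {a : ℂ} (hf : Integrable f circleMeasure)
    (h : ∫ θ, f θ ∂circleMeasure = a) :
    Integrable (fun θ => 1 - 2 * (conj a * f θ).re + ‖a‖ ^ 2) circleMeasure ∧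
      ∫ θ, (1 - 2 * (conj a * f θ).re + ‖a‖ ^ 2) ∂circleMeasure = 1 - ‖a‖ ^ 2 := by
  have hi : Integrable (fun θ => (conj a * f θ).re) circleMeasure := (hf.const_mul _).re
  have hre : ∫ θ, (conj a * f θ).re ∂circleMeasure = ‖a‖ ^ 2 := by
    have h1 : ∫ θ, (conj a * f θ).re ∂circleMeasure = (∫ θ, conj a * f θ ∂circleMeasure).re :=
      integral_re (hf.const_mul (conj a))
    rw [h1, integral_const_mul, h, Complex.conj_mul']
    norm_cast
  have hi1 : Integrable (fun θ => 1 - 2 * (conj a * f θ).re) circleMeasure :=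
    (integrable_const _).sub (hi.const_mul 2)
  refine ⟨hi1.add (integrable_const _), ?_⟩
  rw [integral_add hi1 (integrable_const _), integral_sub (integrable_const _) (hi.const_mul 2),
    integral_const_mul, hre]
  simp
  ring

/-! ### The extremal problem for one inner function -/

section Extremal

variable {J : ℂ → ℂ}

theorem IsInner.integral_norm_sq_boundary (hJ : IsInner J) {F : ℂ → ℂ}
    (hF : IsBoundaryFunction J F) :
    ∫ θ, ‖1 - conj (J 0) * F (circleMap 0 1 θ)‖ ^ 2 ∂circleMeasure = 1 - ‖J 0‖ ^ 2 := by
  -- Only the mean of `F` is needed; `a := 0` avoids assuming `‖J 0‖ < 1`.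
  obtain ⟨hi, h⟩ := hJ.integral_comp hF (a := 0) (by simp) differentiableOn_id
  simp only [id_eq] at hi h
  rw [← (integral_one_sub_two_mul_re hi h).2]
  refine integral_congr_ae ?_
  filter_upwards [ae_circleMeasure (hJ.ae_norm_eq_one hF)] with θ hθ
  rw [norm_one_sub_conj_mul_sq, hθ]
  ring

theorem IsInner.integral_norm_sq_le (hJ : IsInner J) {r : ℝ} (hr : r ∈ Ioo (0 : ℝ) 1) :
    ∫ θ, ‖1 - conj (J 0) * J (circleMap 0 r θ)‖ ^ 2 ∂circleMeasure ≤ 1 - ‖J 0‖ ^ 2 := by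
  obtain ⟨hi, h⟩ := integral_one_sub_two_mul_re
    (memLp_one_iff_integrable.1 (memLp_comp_circleMap hJ.1 hr 1)) (integral_comp_circleMap hJ.1 hr)
  rw [← h]
  refine integral_mono_of_nonneg (Eventually.of_forall fun θ => by positivity) hi
    (Eventually.of_forall fun θ => ?_)
  simp only
  rw [norm_one_sub_conj_mul_sq]
  have h1 : ‖J (circleMap 0 r θ)‖ ^ 2 ≤ 1 :=
    pow_le_one₀ (norm_nonneg _) (hJ.norm_le_one (circleMap_mem_unitBall hr θ))
  nlinarith [sq_nonneg ‖J 0‖]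

/-- The Schwarz–Pick inequality at the origin, for an inner function. -/
theorem IsInner.norm_sub_le (hJ : IsInner J) (ha : ‖J 0‖ < 1) {z : ℂ}
    (hz : z ∈ Metric.ball (0 : ℂ) 1) :
    ‖J z - J 0‖ ≤ ‖z‖ * ‖1 - conj (J 0) * J z‖ := by
  have hne : ∀ w ∈ Metric.ball (0 : ℂ) 1, 1 - conj (J 0) * J w ≠ 0 := fun w hw =>
    factor_ne_zero ha (hJ.norm_le_one hw)
  have hd : DifferentiableOn ℂ (fun w => (J w - J 0) / (1 - conj (J 0) * J w))
      (Metric.ball 0 1) :=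
    (hJ.1.sub_const _).div ((hJ.1.const_mul _).const_sub 1) hne
  -- Schwarz's lemma for `J` followed by the Möbius map sending `J 0` to `0`.
  have hle := Complex.dist_le_div_mul_dist_of_mapsTo_ball (R₂ := 1) hd (fun w hw => by
    simp only [sub_self, zero_div, mem_closedBall_zero_iff, norm_div]
    exact div_le_one_of_le₀ (norm_sub_le_norm_one_sub ha (hJ.norm_le_one hw)) (norm_nonneg _)) hz
  simp only [sub_self, zero_div, dist_zero_right, norm_div, div_one, one_mul] at hle
  rwa [div_le_iff₀ (norm_pos_iff.2 (hne z hz))] at hle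

/-- The upper bound, by Hölder's inequality against the dual extremal function. -/
theorem IsInner.le_of_mem_dualValues {q : ℝ} (hq : 1 < q) (hJ : IsInner J) (ha : ‖J 0‖ < 1)
    {x : ℝ} (hx : x ∈ dualValues q J) : x ≤ (1 - ‖J 0‖ ^ 2) ^ (1 - 1 / q) := by
  obtain ⟨g, G, F, hg, hg1, hG, hF, rfl⟩ := hx
  have hq0 : 0 < q := by linarith
  obtain ⟨p, hpq⟩ : ∃ p, q.HolderConjugate p := ⟨_, Real.HolderConjugate.conjExponent hq⟩
  have hp0 : 0 < p := hpq.symm.pos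
  have hp : 1 / p = 1 - 1 / q := by
    have := hpq.inv_add_inv_eq_one
    rw [one_div, one_div]
    linarith
  set a := J 0 with ha_def
  -- The exponent `2 / p` makes the `p`-th power in Hölder the computable quadratic mean.
  set X := powQuotient a (2 / p)
  have hX : DifferentiableOn ℂ X (factorDomain a) := differentiableOn_powQuotient a _
  have hFX : IsBoundaryFunction (fun z => g z * (z * X (J z))) (fun z => G z * (z * X (F z))) :=
    hG.mul ((isBoundaryFunction_of_continuousAt (φ := fun z => z)
      fun w _ => continuousAt_id).mul (hJ.isBoundaryFunction_comp hF ha hX))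
  obtain ⟨C, hC⟩ := hJ.exists_norm_comp_le ha hX
  have hgX : MemHardy q (fun z => g z * (z * X (J z))) := by
    refine hg.mul_bounded hq (C := 1 * C)
      (differentiableOn_id.mul (hJ.differentiableOn_comp ha hX)) fun z hz => ?_
    rw [norm_mul]
    exact mul_le_mul (mem_ball_zero_iff.1 hz).le (hC z hz) (norm_nonneg _) zero_le_one
  have h0 := hgX.integral_boundary hq hFX
  simp only [zero_mul, mul_zero] at h0
  have hGm := hg.memLp_boundary hq hG
  have hFm := hF.aestronglyMeasurable hJ.1
  have hF1 := ae_circleMeasure (hJ.ae_norm_eq_one hF)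
  have h1q : (1 : ENNReal) ≤ ENNReal.ofReal q := by
    rw [← ENNReal.ofReal_one]
    exact ENNReal.ofReal_le_ofReal hq.le
  have hi1 : Integrable (fun θ => circleMap 0 1 θ *
      (G (circleMap 0 1 θ) * conj (F (circleMap 0 1 θ)))) circleMeasure := by
    refine ((hGm.integrable h1q).norm).mono' ?_ ?_
    · exact (continuous_circleMap 0 1).aestronglyMeasurable.mul
        (hGm.1.mul (Complex.continuous_conj.comp_aestronglyMeasurable hFm))
    · filter_upwards [hF1] with θ hθ
      rw [norm_mul, norm_mul, RCLike.norm_conj, hθ, norm_circleMap_of_pos one_pos, one_mul, mul_one]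
  have hi2 := (hgX.memLp_boundary hq hFX).integrable h1q
  -- The added term `z g X(J)` vanishes at the origin, so its boundary mean is zero.
  have hkey : ∫ θ, circleMap 0 1 θ *
      (G (circleMap 0 1 θ) * conj (F (circleMap 0 1 θ))) ∂circleMeasure =
      ∫ θ, circleMap 0 1 θ * G (circleMap 0 1 θ) *
        (conj (F (circleMap 0 1 θ)) + X (F (circleMap 0 1 θ))) ∂circleMeasure := by
    have h2 := integral_add hi1 hi2
    rw [h0, add_zero] at h2
    rw [← h2]
    congr 1 with θ
    ring
  have hnorm : ∀ᵐ θ ∂circleMeasure, ‖conj (F (circleMap 0 1 θ)) + X (F (circleMap 0 1 θ))‖ =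
      ‖1 - conj a * F (circleMap 0 1 θ)‖ ^ (2 / p) := by
    filter_upwards [hF1] with θ hθ
    set w := F (circleMap 0 1 θ)
    have h1 : powFactor a (2 / p) w = w * (conj w + X w) := by
      rw [powFactor_eq, mul_add, Complex.mul_conj', hθ]
      simp [X]
    rw [← norm_powFactor, h1, norm_mul, hθ, one_mul]
  set u : ℝ → ℝ := fun θ => ‖1 - conj a * F (circleMap 0 1 θ)‖ ^ (2 / p) with hu
  have hum : MemLp u (ENNReal.ofReal p) circleMeasure := by
    refine MemLp.of_bound (C := 2 ^ (2 / p)) ?_ ?_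
    · have h1 : Continuous fun w : ℂ => ‖1 - conj a * w‖ ^ (2 / p) :=
        Continuous.rpow_const (by fun_prop) fun _ => Or.inr (by positivity)
      exact h1.comp_aestronglyMeasurable hFm
    · filter_upwards [hF1] with θ hθ
      rw [Real.norm_of_nonneg (by positivity)]
      have h1 : ‖1 - conj a * F (circleMap 0 1 θ)‖ ≤ 2 := by
        refine (_root_.norm_sub_le _ _).trans ?_
        rw [norm_mul, hθ, norm_one, RCLike.norm_conj]
        linarith
      exact Real.rpow_le_rpow (norm_nonneg _) h1 (by positivity)
  have hup : ∫ θ, u θ ^ p ∂circleMeasure = 1 - ‖a‖ ^ 2 := by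
    rw [← hJ.integral_norm_sq_boundary hF]
    congr 1 with θ
    rw [hu]
    simp only
    rw [← Real.rpow_mul (norm_nonneg _), div_mul_cancel₀ _ hp0.ne', Real.rpow_two]
  have hGq : (∫ θ, ‖G (circleMap 0 1 θ)‖ ^ q ∂circleMeasure) ^ (1 / q) ≤ 1 := by
    have h1 := hg.eLpNorm_boundary_le hq hG
    rw [hGm.eLpNorm_eq_integral_rpow_norm (by simpa using hq0) ENNReal.ofReal_ne_top,
      ENNReal.toReal_ofReal hq0.le, ← one_div] at h1
    refine le_trans ((ENNReal.ofReal_le_ofReal_iff ?_).1 h1) hg1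
    exact Real.rpow_nonneg (sSup_integralMeans_nonneg q g) _
  have hint : Integrable (fun θ => ‖G (circleMap 0 1 θ)‖ * u θ) circleMeasure :=
    haveI : ENNReal.HolderConjugate (ENNReal.ofReal q) (ENNReal.ofReal p) := hpq.ennrealOfReal
    hGm.norm.integrable_mul hum
  rw [integral_eq_circleIntegral, hkey]
  calc _ ≤ ∫ θ, ‖G (circleMap 0 1 θ)‖ * u θ ∂circleMeasure := by
        refine norm_integral_le_of_norm_le hint ?_
        filter_upwards [hnorm] with θ hθ
        rw [norm_mul, norm_mul, hθ, norm_circleMap_of_pos one_pos, one_mul]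
    _ ≤ (∫ θ, ‖G (circleMap 0 1 θ)‖ ^ q ∂circleMeasure) ^ (1 / q) *
        (∫ θ, u θ ^ p ∂circleMeasure) ^ (1 / p) :=
        integral_mul_le_Lp_mul_Lq_of_nonneg hpq (Eventually.of_forall fun θ => norm_nonneg _)
          (Eventually.of_forall fun θ => by positivity) hGm.norm hum
    _ ≤ 1 * (1 - ‖a‖ ^ 2) ^ (1 / p) := by
        rw [hup]
        refine mul_le_mul_of_nonneg_right hGq (Real.rpow_nonneg ?_ _)
        have := pow_le_one₀ (n := 2) (norm_nonneg a) ha.le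
        linarith
    _ = _ := by rw [one_mul, hp]

/-- The bound is attained by a multiple of `(J - J 0) / z * (1 - conj (J 0) * J) ^ (2 / q - 1)`. -/
theorem IsInner.mem_dualValues {q : ℝ} (hq : 1 < q) (hJ : IsInner J) (ha : ‖J 0‖ < 1) :
    (1 - ‖J 0‖ ^ 2) ^ (1 - 1 / q) ∈ dualValues q J := by
  have hq0 : 0 < q := by linarith
  obtain ⟨F, hF, -⟩ := hJ.2.2
  set a := J 0 with ha_def
  set s := 2 / q - 1 with hs
  have hm0 : 0 < 1 - ‖a‖ ^ 2 := by
    have := pow_lt_one₀ (norm_nonneg a) ha two_ne_zero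
    linarith
  set m := 1 - ‖a‖ ^ 2 with hm
  -- Normalization: `c ^ q = m⁻¹` offsets the quadratic mean, which is at most `m`.
  set c : ℝ := m ^ (-(1 / q)) with hc
  have hc0 : 0 < c := by positivity
  have hcq : c ^ q = m⁻¹ := by
    rw [hc, ← Real.rpow_mul hm0.le, neg_mul, one_div_mul_cancel hq0.ne', Real.rpow_neg_one]
  have hP : DifferentiableOn ℂ (powFactor a s) (factorDomain a) := differentiableOn_powFactor a s
  have hX : DifferentiableOn ℂ (powQuotient a s) (factorDomain a) :=
    differentiableOn_powQuotient a s
  -- `dslope` fills the removable singularity of `(J - a) / z` at the origin.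
  set g : ℂ → ℂ := fun z => c * (dslope J 0 z * powFactor a s (J z)) with hg
  set G : ℂ → ℂ := fun z => c * ((F z - a) / z * powFactor a s (F z)) with hG
  have hgd : DifferentiableOn ℂ g (Metric.ball 0 1) :=
    (((Complex.differentiableOn_dslope (Metric.ball_mem_nhds 0 one_pos)).2 hJ.1).mul
      (hJ.differentiableOn_comp ha hP)).const_mul _
  have hGb : IsBoundaryFunction g G := by
    filter_upwards [hF, hJ.isBoundaryFunction_comp hF ha hP] with θ h1 h2 M hM
    refine ((Tendsto.congr' ?_ (((h1 M hM).sub_const a).div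
      (tendsto_id.mono_left nhdsWithin_le_nhds) (circleMap_one_ne_zero θ))).mul
      (h2 M hM)).const_mul _
    filter_upwards [nhdsWithin_le_nhds (isOpen_ne.mem_nhds (circleMap_one_ne_zero θ))] with z hz
    rw [dslope_of_ne _ hz, slope_def_field, sub_zero]
    rfl
  have hle : ∀ r ∈ Ioo (0 : ℝ) 1, ∫ θ, ‖g (circleMap 0 r θ)‖ ^ q ∂circleMeasure ≤ 1 := by
    intro r hr
    have hi : Integrable (fun θ => ‖1 - conj a * J (circleMap 0 r θ)‖ ^ 2) circleMeasure := by
      have h1 : MemLp (fun θ => 1 - conj a * J (circleMap 0 r θ)) 2 circleMeasure :=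
        memLp_comp_circleMap ((hJ.1.const_mul (conj a)).const_sub 1) hr 2
      exact h1.integrable_norm_pow (by norm_num)
    calc ∫ θ, ‖g (circleMap 0 r θ)‖ ^ q ∂circleMeasure
        ≤ ∫ θ, m⁻¹ * ‖1 - conj a * J (circleMap 0 r θ)‖ ^ 2 ∂circleMeasure := by
          refine integral_mono_of_nonneg (Eventually.of_forall fun θ => by positivity)
            (hi.const_mul _) (Eventually.of_forall fun θ => ?_)
          have hz := circleMap_mem_unitBall hr θ
          have hzn := norm_circleMap_of_pos hr.1 θ
          set z := circleMap 0 r θ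
          have hz0 : z ≠ 0 := by
            rw [← norm_pos_iff, hzn]
            exact hr.1
          have hpos : 0 < ‖1 - conj a * J z‖ :=
            norm_pos_iff.2 (factor_ne_zero ha (hJ.norm_le_one hz))
          have h1 : ‖dslope J 0 z‖ ≤ ‖1 - conj a * J z‖ := by
            rw [dslope_of_ne _ hz0, slope_def_field, sub_zero, norm_div,
              div_le_iff₀ (norm_pos_iff.2 hz0), mul_comm]
            exact hJ.norm_sub_le ha hz
          have h2 : ‖g z‖ ≤ c * ‖1 - conj a * J z‖ ^ (2 / q) := by
            have h3 : ‖1 - conj a * J z‖ ^ (2 / q) =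
                ‖1 - conj a * J z‖ * ‖1 - conj a * J z‖ ^ s := by
              rw [← Real.rpow_one_add' hpos.le (by rw [hs]; ring_nf; positivity), hs]
              congr 1
              ring
            rw [hg, h3]
            simp only
            rw [norm_mul, norm_mul, norm_powFactor, Complex.norm_real, Real.norm_of_nonneg hc0.le]
            gcongr
          calc ‖g z‖ ^ q ≤ (c * ‖1 - conj a * J z‖ ^ (2 / q)) ^ q := by gcongr
            _ = m⁻¹ * ‖1 - conj a * J z‖ ^ 2 := by
              rw [Real.mul_rpow hc0.le (by positivity), hcq, ← Real.rpow_mul hpos.le,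
                div_mul_cancel₀ _ hq0.ne', Real.rpow_two]
      _ ≤ m⁻¹ * m := by
          rw [integral_const_mul]
          gcongr
          exact hJ.integral_norm_sq_le hr
      _ = 1 := inv_mul_cancel₀ hm0.ne'
  obtain ⟨hgH, hgS⟩ := memHardy_of_integral_le hgd hle
  refine ⟨g, G, F, hgH, Real.rpow_le_one (sSup_integralMeans_nonneg q g) hgS (by positivity),
    hGb, hF, ?_⟩
  rw [integral_eq_circleIntegral]
  -- With `P = 1 + F X` and `|F| = 1`, `(F - a) P conj F = P - a (conj F + X)`. Its mean is `P(a) -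
  -- a (conj a + X(a)) = 1 - |a|²`.
  have hval : ∫ θ, circleMap 0 1 θ *
      (G (circleMap 0 1 θ) * conj (F (circleMap 0 1 θ))) ∂circleMeasure = ((c * m : ℝ) : ℂ) := by
    obtain ⟨hPi, hPv⟩ := hJ.integral_comp hF ha hP
    obtain ⟨hXi, hXv⟩ := hJ.integral_comp hF ha hX
    obtain ⟨hFi, hFv⟩ := hJ.integral_comp hF ha differentiableOn_id
    simp only [id_eq] at hFi hFv
    have hFc : Integrable (fun θ => conj (F (circleMap 0 1 θ))) circleMeasure :=
      Complex.conjCLE.toContinuousLinearMap.integrable_comp hFi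
    have hFX : Integrable (fun θ => a * (conj (F (circleMap 0 1 θ)) +
        powQuotient a s (F (circleMap 0 1 θ)))) circleMeasure := (hFc.add hXi).const_mul a
    calc _ = ∫ θ, (c : ℂ) * (powFactor a s (F (circleMap 0 1 θ)) -
          a * (conj (F (circleMap 0 1 θ)) + powQuotient a s (F (circleMap 0 1 θ))))
          ∂circleMeasure := by
          refine integral_congr_ae ?_
          filter_upwards [ae_circleMeasure (hJ.ae_norm_eq_one hF)] with θ hθ
          have h1 : F (circleMap 0 1 θ) * conj (F (circleMap 0 1 θ)) = 1 := by
            rw [Complex.mul_conj', hθ]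
            simp
          have h2 := circleMap_one_ne_zero θ
          have h3 := powFactor_eq a s (F (circleMap 0 1 θ))
          have h4 : circleMap 0 1 θ * ((F (circleMap 0 1 θ) - a) / circleMap 0 1 θ) =
            F (circleMap 0 1 θ) - a := mul_div_cancel₀ _ h2
          simp only [hG]
          linear_combination (c * powFactor a s (F (circleMap 0 1 θ)) *
            conj (F (circleMap 0 1 θ))) * h4 + (c * powFactor a s (F (circleMap 0 1 θ))
            - c * a * powQuotient a s (F (circleMap 0 1 θ))) * h1
            - c * a * conj (F (circleMap 0 1 θ)) * h3
      _ = c * (powFactor a s a - a * (conj a + powQuotient a s a)) := by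
          rw [integral_const_mul, integral_sub hPi hFX,
            integral_const_mul, integral_add hFc hXi, hPv, hXv, integral_conj, hFv]
      _ = ((c * m : ℝ) : ℂ) := by
          rw [powFactor_eq, hm]
          push_cast
          rw [← Complex.mul_conj']
          ring
  rw [hval, Complex.norm_real, Real.norm_of_nonneg (by positivity), hc,
    ← Real.rpow_add_one hm0.ne']
  congr 1
  ring

theorem IsInner.isGreatest_dualValues {q : ℝ} (hq : 1 < q) (hJ : IsInner J) (ha : ‖J 0‖ < 1) :
    IsGreatest (dualValues q J) ((1 - ‖J 0‖ ^ 2) ^ (1 - 1 / q)) :=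
  ⟨hJ.mem_dualValues hq ha, fun _ hx => hJ.le_of_mem_dualValues hq ha hx⟩

end Extremal

end HardyDual

end

/-! ### Comparison of the two suprema -/

theorem corollary3p5 (q : ℝ) (hq : 1 < q) (J₁ J₂ : ℂ → ℂ)
    (hJ₁ : HardyDual.IsInner J₁) (hJ₂ : HardyDual.IsInner J₂)
    (hc₁ : ¬ HardyDual.IsConstantOnDisk J₁) (hc₂ : ¬ HardyDual.IsConstantOnDisk J₂)
    (h₁ : J₁ 0 ≠ 0) (h₂ : J₂ 0 ≠ 0) :
    BddAbove (HardyDual.dualValues q J₁) ∧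
    BddAbove (HardyDual.dualValues q (fun z => J₁ z * J₂ z)) ∧
    sSup (HardyDual.dualValues q J₁) <
      sSup (HardyDual.dualValues q (fun z => J₁ z * J₂ z)) := by
  have ha₁ := hJ₁.norm_zero_lt_one hc₁
  have ha₂ := hJ₂.norm_zero_lt_one hc₂
  have hlt : ‖J₁ 0 * J₂ 0‖ < ‖J₁ 0‖ := by
    rw [norm_mul]
    exact mul_lt_of_lt_one_right (norm_pos_iff.2 h₁) ha₂
  have g₁ := hJ₁.isGreatest_dualValues hq ha₁
  have g₂ := (hJ₁.mul hJ₂).isGreatest_dualValues hq (hlt.trans ha₁)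
  refine ⟨g₁.bddAbove, g₂.bddAbove, ?_⟩
  rw [g₁.csSup_eq, g₂.csSup_eq]
  have hsq : ‖J₁ 0 * J₂ 0‖ ^ 2 < ‖J₁ 0‖ ^ 2 := pow_lt_pow_left₀ hlt (norm_nonneg _) two_ne_zero
  have h1 : ‖J₁ 0‖ ^ 2 < 1 := pow_lt_one₀ (norm_nonneg _) ha₁ two_ne_zero
  have hexp : 0 < 1 - 1 / q := by
    rw [sub_pos, div_lt_one (by linarith)]
    exact hq
  exact Real.rpow_lt_rpow (by linarith) (by linarith) hexp
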